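/- Let $d\in\mathbb N$ and write $z=(x,\xi)\in\mathbb R^{2d}$. Let $\rho(z)$ be the symmetric time-frequency shift on $L^2(\mathbb R^d)$, $\rho(x,\xi)f(t)=e^{-\pi i x\cdot\xi}e^{2\pi i\xi\cdot t}f(t-x)$. Let $\mathcal S^1$ be the space of trace-class operators on $L^2(\mathbb R^d)$, normed by $\|T\|_{\mathcal S^1}=\sum_n s_n(T)$, the sum of the singular values. For $T\in\mathcal S^1$ let $\mathcal F_W(T)(z)=\operatorname{tr}(T\rho(z)^*)$ be its Fourier–Wigner transform. For $m\in L^\infty(\mathbb R^{2d})$ (complex-valued) let $\mathfrak T_m(T)=\int_{\mathbb R^{2d}}m(z)\,\mathcal F_W(T)(z)\,\rho(z)\,dz$, the integral being taken weakly, that is, $\langle \mathfrak T_m(T)f,g\rangle=\int_{\mathbb R^{2d}}m(z)\,\mathcal F_W(T)(z)\,\langle\rho(z)f,g\rangle\,dz$ for all $f,g\in L^2(\mathbb R^d)$. Let $\mathfrak M_1(\mathbb R^{2d})$ be the set of all $m\in L^\infty(\mathbb R^{2d})$ for which $\mathfrak T_m$ is a bounded linear operator from $\mathcal S^1$ to $\mathcal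 S^1$. **Proposition.** If $m\in\mathfrak M_1(\mathbb R^{2d})$, then $m\in C_b(\mathbb R^{2d})$; that is, there is a bounded continuous function $g:\mathbb R^{2d}\to\mathbb C$ with $m=g$ almost everywhere. -/

import Mathlib

open MeasureTheory
open scoped ENNReal NNReal InnerProductSpace BoundedContinuousFunction

noncomputable section

namespace FourierWigner

/-! ### Trace-class operators on a complex Hilbert space -/

section TraceClass

variable {H : Type*} [NormedAddCommGroup H] [InnerProductSpace ℂ H]

/-- A singular value decomposition `T = ∑ i, s i • (e i ⊗ η i)` of a bounded operator, with
`e` and `η` (finite or countable) orthonormal families, `s i ≥ 0`, and `e ⊗ η` the rank-one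
operator `f ↦ ⟨f, η⟩ e`, with `⟨·, ·⟩` linear in the first variable (Mathlib's `⟪η, f⟫` is linear
in the second one). -/
structure SVD (T : H →L[ℂ] H) where
  ι : Type
  countable : Countable ι
  s : ι → ℝ≥0
  e : ι → H
  η : ι → H
  orthonormal_e : Orthonormal ℂ e
  orthonormal_η : Orthonormal ℂ η
  hasSum : ∀ f : H, HasSum (fun i => ((s i : ℝ) : ℂ) • (⟪η i, f⟫_ℂ • e i)) (T f)

/-- The trace norm `‖T‖_{S¹}`: the sum of the singular values of `T`. Singular value
decompositions of `T` all have the same sum; it is `∞` if there is none. -/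
def traceNorm (T : H →L[ℂ] H) : ℝ≥0∞ :=
  ⨅ D : SVD T, ∑' i, (D.s i : ℝ≥0∞)

/-- Membership in the trace class `S¹`. -/
def IsTraceClass (T : H →L[ℂ] H) : Prop :=
  traceNorm T < ∞

/-- The trace `∑ i, ⟨A b i, b i⟩` of an operator, in some orthonormal basis `b` of `H`. For a
trace-class operator the sum converges absolutely and does not depend on the basis. -/
def trace [CompleteSpace H] (A : H →L[ℂ] H) : ℂ :=
  let b := (exists_hilbertBasis ℂ H).choose_spec.choose
  ∑' i, ⟪b i, A (b i)⟫_ℂ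

end TraceClass

/-! ### Time-frequency shifts on `L²(ℝᵈ)` -/

/-- The Hilbert space `L²(ℝᵈ)`. -/
abbrev L2 (d : ℕ) : Type :=
  Lp ℂ 2 (volume : Measure (EuclideanSpace ℝ (Fin d)))

/-- Phase space `ℝ²ᵈ`, with points `z = (x, ξ)`, its usual topology and Lebesgue measure. -/
abbrev Phase (d : ℕ) : Type :=
  EuclideanSpace ℝ (Fin d) × EuclideanSpace ℝ (Fin d)

variable {d : ℕ}

/-- `e^{-π i x·ξ} e^{2 π i ξ·t} f(t - x)`, as a function of `t`. -/
def shiftFun (z : Phase d) (f : EuclideanSpace ℝ (Fin d) → ℂ) (t : EuclideanSpace ℝ (Fin d)) : ℂ :=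
  Complex.exp (-(Real.pi * Complex.I * (inner ℝ z.1 z.2 : ℝ)))
    * Complex.exp (2 * Real.pi * Complex.I * (inner ℝ z.2 t : ℝ)) * f (t - z.1)

lemma norm_shiftFun (z : Phase d) (f : EuclideanSpace ℝ (Fin d) → ℂ)
    (t : EuclideanSpace ℝ (Fin d)) : ‖shiftFun z f t‖ = ‖f (t - z.1)‖ := by
  have h1 : ‖Complex.exp (-(Real.pi * Complex.I * (inner ℝ z.1 z.2 : ℝ)))‖ = 1 := by
    rw [Complex.norm_exp]; simp
  have h2 : ‖Complex.exp (2 * Real.pi * Complex.I * (inner ℝ z.2 t : ℝ))‖ = 1 := by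
    rw [Complex.norm_exp]; simp
  rw [shiftFun, norm_mul, norm_mul, h1, h2, one_mul, one_mul]

lemma measurePreserving_sub (x : EuclideanSpace ℝ (Fin d)) :
    MeasurePreserving (fun t : EuclideanSpace ℝ (Fin d) => t - x) volume volume :=
  measurePreserving_sub_right volume x

lemma shiftFun_congr (z : Phase d) {f g : EuclideanSpace ℝ (Fin d) → ℂ} (h : f =ᵐ[volume] g) :
    shiftFun z f =ᵐ[volume] shiftFun z g := by
  filter_upwards [(measurePreserving_sub z.1).quasiMeasurePreserving.ae_eq_comp h] with t ht
  have ht' : f (t - z.1) = g (t - z.1) := ht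
  rw [shiftFun, shiftFun, ht']

lemma memLp_shiftFun (z : Phase d) (f : L2 d) : MemLp (shiftFun z f) 2 volume := by
  have h := (Lp.memLp f).comp_measurePreserving (measurePreserving_sub z.1)
  refine h.of_le ?_ (Filter.Eventually.of_forall fun t => (norm_shiftFun z f t).le)
  refine AEStronglyMeasurable.mul (Continuous.aestronglyMeasurable ?_) h.1
  fun_prop

lemma eLpNorm_shiftFun (z : Phase d) (f : L2 d) :
    eLpNorm (shiftFun z f) 2 volume = eLpNorm f 2 volume := by
  rw [← eLpNorm_comp_measurePreserving (Lp.aestronglyMeasurable f) (measurePreserving_sub z.1)]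
  exact eLpNorm_congr_norm_ae (Filter.Eventually.of_forall fun t => norm_shiftFun z f t)

/-- The symmetric time-frequency shift
`ρ(x, ξ) f(t) = e^{-π i x·ξ} e^{2 π i ξ·t} f(t - x)`, a bounded operator on `L²(ℝᵈ)`. -/
def rho (z : Phase d) : L2 d →L[ℂ] L2 d :=
  LinearMap.mkContinuous
    { toFun := fun f => (memLp_shiftFun z f).toLp
      map_add' := fun f g => by
        rw [← MemLp.toLp_add]
        refine MemLp.toLp_congr _ _ ((shiftFun_congr z (Lp.coeFn_add f g)).trans ?_)
        exact Filter.Eventually.of_forall fun t => by simp [shiftFun, mul_add]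
      map_smul' := fun c f => by
        rw [RingHom.id_apply, ← MemLp.toLp_const_smul]
        refine MemLp.toLp_congr _ _ ((shiftFun_congr z (Lp.coeFn_smul c f)).trans ?_)
        exact Filter.Eventually.of_forall fun t => by simp [shiftFun]; ring }
    1 fun f => by
      rw [one_mul, LinearMap.coe_mk, AddHom.coe_mk, Lp.norm_toLp, eLpNorm_shiftFun, Lp.norm_def]

lemma rho_apply (z : Phase d) (f : L2 d) : rho z f =ᵐ[volume] shiftFun z f :=
  (memLp_shiftFun z f).coeFn_toLp

/-! ### Fourier–Wigner transform and multipliers -/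

/-- The Fourier–Wigner transform `F_W(T)(z) = tr(T ρ(z)*)`. -/
def fourierWigner (T : L2 d →L[ℂ] L2 d) (z : Phase d) : ℂ :=
  trace (T ∘L ContinuousLinearMap.adjoint (rho z))

/-- `S = ∫ F(z) ρ(z) dz` weakly: `⟨S f, g⟩ = ∫ F(z) ⟨ρ(z) f, g⟩ dz` for all `f, g ∈ L²(ℝᵈ)`. Such
an `S` is unique. -/
def HasWeakIntegral (F : Phase d → ℂ) (S : L2 d →L[ℂ] L2 d) : Prop :=
  ∀ f g : L2 d, Integrable (fun z => F z * ⟪g, rho z f⟫_ℂ) volume ∧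
    ⟪g, S f⟫_ℂ = ∫ z, F z * ⟪g, rho z f⟫_ℂ

/-- `S = 𝔗_m T = ∫ m(z) F_W(T)(z) ρ(z) dz`, the image of `T` under the Fourier–Wigner multiplier
operator with symbol `m`. -/
def IsMultiplierImage (m : Phase d → ℂ) (T S : L2 d →L[ℂ] L2 d) : Prop :=
  HasWeakIntegral (fun z => m z * fourierWigner T z) S

/-- The set `𝔐₁(ℝ²ᵈ)` of trace-class Fourier–Wigner multipliers: all `m ∈ L^∞(ℝ²ᵈ)` for which
`𝔗_m` is a bounded operator from `S¹` to `S¹`. -/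
def traceClassMultipliers (d : ℕ) : Set (Lp ℂ ∞ (volume : Measure (Phase d))) :=
  {m | ∃ C : ℝ≥0, ∀ T : L2 d →L[ℂ] L2 d, IsTraceClass T →
    ∃ S : L2 d →L[ℂ] L2 d, IsMultiplierImage m T S ∧ IsTraceClass S ∧
      traceNorm S ≤ C * traceNorm T}

end FourierWigner

end

noncomputable section

namespace FourierWigner

open scoped FourierTransform SchwartzMap

/-! It suffices to apply the multiplier to one operator: the rank-one Gaussian operator `T = φ ⊗ φ`,
whose Fourier–Wigner transform `A = gaussAmb` is continuous and vanishes nowhere. Its image `S` is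
trace class, so the Fourier–Wigner series of a singular value decomposition of `S` converges
uniformly to a continuous function `F` (`SVD.transform`). If `m * A = F` almost everywhere, then `m`
has the continuous representative `F / A`.

This identity comes from testing `S` on the Gaussians `φ_w` centred at `w`, for which `⟨ρ(z) φ_w,
φ_w⟩ = χ_w(z) A(z)` with a symplectic character `χ_w` (`inner_gauss_rho_gauss`). The weak definition
of `S` gives `⟨S φ_w, φ_w⟩ = ∫ m A χ_w A`, while Moyal's identity (`integral_inner_rho_mul`), summed
over the decomposition, gives `∫ F χ_w A`. Hence the integrable function `(m A - F) A` has zero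
symplectic Fourier transform and vanishes almost everywhere. -/

/-! ### Injectivity of the Fourier transform on integrable functions. -/

theorem ae_eq_zero_of_fourier_eq_zero {V : Type*} [NormedAddCommGroup V] [InnerProductSpace ℝ V]
    [FiniteDimensional ℝ V] [MeasurableSpace V] [BorelSpace V] {f : V → ℂ}
    (hf : Integrable f) (h : ∀ w, 𝓕 f w = 0) : f =ᵐ[volume] 0 := by
  refine ae_eq_zero_of_integral_contDiff_smul_eq_zero hf.locallyIntegrable fun g hg hgs => ?_
  have hgs' : HasCompactSupport (fun x => (g x : ℂ)) :=
    hgs.comp_left (g := fun r : ℝ => (r : ℂ)) Complex.ofReal_zero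
  have hg' : ContDiff ℝ (⊤ : ℕ∞) (fun x => (g x : ℂ)) := Complex.ofRealCLM.contDiff.comp hg
  -- The test function is the Fourier transform of a Schwartz function `θ`, and `∫ 𝓕 f * θ = ∫ f * 𝓕
  -- θ`.
  let ψ : 𝓢(V, ℂ) := hgs'.toSchwartzMap hg'
  let θ : 𝓢(V, ℂ) := 𝓕⁻ ψ
  have hθ : 𝓕 (θ : V → ℂ) = fun x => (g x : ℂ) := by
    have : 𝓕 θ = ψ := FourierTransform.fourier_fourierInv_eq ψ
    rw [← SchwartzMap.fourier_coe, this]; rfl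
  have key := VectorFourier.integral_fourierIntegral_smul_eq_flip (L := innerₗ V) (e := 𝐞)
    (μ := volume) (ν := volume) Real.continuous_fourierChar
    (by exact continuous_inner) hf θ.integrable
  rw [flip_innerₗ] at key
  have h1 : ∀ w, VectorFourier.fourierIntegral 𝐞 volume (innerₗ V) f w = 0 := h
  have h2 : ∀ w, VectorFourier.fourierIntegral 𝐞 volume (innerₗ V) (θ : V → ℂ) w = g w :=
    fun w => congrFun hθ w
  simp only [h1, h2, zero_smul, integral_zero] at key
  rw [key]
  exact integral_congr_ae (Filter.Eventually.of_forall fun x => by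
    simp [mul_comm])

variable {d : ℕ}

/-- The symplectic character `z ↦ e^{2πi(ξ·a - x·b)}` of phase space. -/
def symplecticChar (w z : Phase d) : ℂ :=
  Complex.exp (2 * Real.pi * Complex.I * ((inner ℝ z.2 w.1 - inner ℝ z.1 w.2 : ℝ) : ℂ))

lemma norm_symplecticChar (w z : Phase d) : ‖symplecticChar w z‖ = 1 := by
  rw [symplecticChar, Complex.norm_exp]; simp

@[fun_prop]
lemma continuous_symplecticChar (w : Phase d) : Continuous (symplecticChar w) := by
  unfold symplecticChar; fun_prop

/-- A quarter turn of the parameter, `w ↦ (-w.snd, w.fst)`, turns symplectic characters into Fourier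
characters. The type `WithLp 2` supplies the inner product that the sup-normed product lacks. -/
theorem ae_eq_zero_of_integral_symplecticChar_eq_zero {H : Phase d → ℂ} (hH : Integrable H)
    (h : ∀ w, ∫ z, symplecticChar w z * H z = 0) : H =ᵐ[volume] 0 := by
  let V := WithLp 2 (Phase d)
  have hmp : MeasurePreserving (WithLp.ofLp : V → Phase d) :=
    WithLp.volume_preserving_ofLp _ _
  have hemb : MeasurableEmbedding (WithLp.ofLp : V → Phase d) :=
    (MeasurableEquiv.toLp 2 (Phase d)).symm.measurableEmbedding
  have hH' : Integrable (fun v : V => H v.ofLp) := hmp.integrable_comp_of_integrable hH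
  have h0 := ae_eq_zero_of_fourier_eq_zero hH' fun w => by
    rw [Real.fourier_eq']
    rw [← h (-w.snd, w.fst), ← hmp.integral_comp hemb]
    refine integral_congr_ae (Filter.Eventually.of_forall fun v => ?_)
    simp only [symplecticChar, smul_eq_mul]
    congr 2
    rw [WithLp.prod_inner_apply]
    simp
    ring
  have h1 := (WithLp.volume_preserving_toLp (EuclideanSpace ℝ (Fin d))
    (EuclideanSpace ℝ (Fin d))).quasiMeasurePreserving.ae_eq_comp h0
  exact h1

/-! ### Gaussians and their ambiguity function. -/

lemma inner_rho (z : Phase d) (f g : L2 d) :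
    ⟪rho z f, g⟫_ℂ = ∫ t, starRingEnd ℂ (shiftFun z f t) * g t := by
  rw [L2.inner_def]
  refine integral_congr_ae ?_
  filter_upwards [rho_apply z f] with t ht
  rw [ht, RCLike.inner_apply, mul_comm]

/-- The Gaussian `t ↦ e^{2πi b·t} e^{-π|t-a|²}` centred at `w = (a, b)` in phase space. -/
def gaussFun (w : Phase d) (t : EuclideanSpace ℝ (Fin d)) : ℂ :=
  Complex.exp (2 * Real.pi * Complex.I * (inner ℝ w.2 t : ℝ)) *
    Complex.exp (-(Real.pi * (‖t - w.1‖ ^ 2 : ℝ)))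

@[fun_prop]
lemma continuous_gaussFun (w : Phase d) : Continuous (gaussFun w) := by
  unfold gaussFun; fun_prop

lemma norm_gaussFun (w : Phase d) (t : EuclideanSpace ℝ (Fin d)) :
    ‖gaussFun w t‖ = Real.exp (-(Real.pi * ‖t - w.1‖ ^ 2)) := by
  rw [gaussFun, norm_mul, Complex.norm_exp, Complex.norm_exp, ← Complex.ofReal_mul,
    ← Complex.ofReal_neg, Complex.ofReal_re]
  simp

lemma conj_gaussFun (w : Phase d) (t : EuclideanSpace ℝ (Fin d)) :
    starRingEnd ℂ (gaussFun w t) = Complex.exp (-(2 * Real.pi * Complex.I * (inner ℝ w.2 t : ℝ))) *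
      Complex.exp (-(Real.pi * (‖t - w.1‖ ^ 2 : ℝ))) := by
  rw [gaussFun, map_mul, ← Complex.exp_conj, ← Complex.exp_conj]
  simp only [map_mul, map_neg, Complex.conj_ofReal, Complex.conj_I, map_ofNat]
  congr 2
  ring

lemma integrable_exp_neg_mul_sq_norm {V : Type*} [NormedAddCommGroup V] [InnerProductSpace ℝ V]
    [FiniteDimensional ℝ V] [MeasurableSpace V] [BorelSpace V] {b : ℝ} (hb : 0 < b) :
    Integrable (fun v : V => Real.exp (-(b * ‖v‖ ^ 2))) := by
  have := (GaussianFourier.integrable_cexp_neg_mul_sq_norm_add (V := V) (b := b)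
    (by simpa using hb) 0 0).norm
  refine this.congr (Filter.Eventually.of_forall fun v => ?_)
  simp [Complex.norm_exp, ← Complex.ofReal_pow]

lemma memLp_gaussFun (w : Phase d) : MemLp (gaussFun w) 2 volume := by
  rw [memLp_two_iff_integrable_sq_norm (continuous_gaussFun w).aestronglyMeasurable]
  have h := (integrable_exp_neg_mul_sq_norm (V := EuclideanSpace ℝ (Fin d))
    (b := 2 * Real.pi) (by positivity)).comp_sub_right w.1
  refine h.congr (Filter.Eventually.of_forall fun t => ?_)
  simp only [norm_gaussFun]
  rw [← Real.exp_nat_mul]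
  congr 1; push_cast; ring

/-- The Gaussian centred at `w` as a vector of `L²(ℝᵈ)`. -/
def gauss (w : Phase d) : L2 d := (memLp_gaussFun w).toLp

lemma gauss_apply (w : Phase d) : gauss w =ᵐ[volume] gaussFun w := (memLp_gaussFun w).coeFn_toLp

/-- The ambiguity function of the Gaussian, `2^{-d/2} e^{-π|z|²/2}`. -/
def gaussAmb (z : Phase d) : ℂ :=
  (1 / 2 : ℂ) ^ (d / 2 : ℂ) * Complex.exp (-(Real.pi / 2 * (‖z.1‖ ^ 2 + ‖z.2‖ ^ 2 : ℝ)))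

/-- By the parallelogram law, the Gaussians centred at `w.1` and `w.1 + z.1` multiply to a Gaussian
about their midpoint, so the coefficient is a Gaussian Fourier integral; recentring at the midpoint
produces the character. -/
lemma inner_gauss_rho_gauss (w z : Phase d) :
    ⟪gauss w, rho z (gauss w)⟫_ℂ = symplecticChar w z * gaussAmb z := by
  have h1 : ⟪gauss w, rho z (gauss w)⟫_ℂ
      = ∫ t, starRingEnd ℂ (gaussFun w t) * shiftFun z (gaussFun w) t := by
    rw [L2.inner_def]
    refine integral_congr_ae ?_
    filter_upwards [rho_apply z (gauss w), gauss_apply w, shiftFun_congr z (gauss_apply w)]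
      with t ht h2 h3
    rw [ht, h2, h3, RCLike.inner_apply, mul_comm]
  have h2 : ∀ t, starRingEnd ℂ (gaussFun w t) * shiftFun z (gaussFun w) t =
      symplecticChar w z * Complex.exp (-(Real.pi / 2 * (‖z.1‖ ^ 2 : ℝ))) *
      Complex.exp (-(2 * Real.pi : ℝ) * ‖t - (w.1 + (1/2 : ℝ) • z.1)‖ ^ 2
        + (2 * Real.pi * Complex.I) * (inner ℝ z.2 (t - (w.1 + (1/2 : ℝ) • z.1)) : ℝ)) := by
    intro t
    simp only [conj_gaussFun]
    simp only [gaussFun, shiftFun, symplecticChar, ← Complex.exp_add]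
    congr 1
    have e1 : ‖t - (w.1 + (1/2 : ℝ) • z.1)‖ ^ 2 =
      (‖t - w.1‖ ^ 2 + ‖t - z.1 - w.1‖ ^ 2) / 2 - ‖z.1‖ ^ 2 / 4 := by
      have e2 : t - z.1 - w.1 = (t - w.1) - z.1 := by abel
      have e3 : t - (w.1 + (1/2 : ℝ) • z.1) = (t - w.1) - (1/2 : ℝ) • z.1 := by abel
      rw [e2, e3]
      generalize t - w.1 = u
      rw [norm_sub_sq_real, norm_sub_sq_real, inner_smul_right, norm_smul]
      norm_num
      ring
    rw [← Complex.ofReal_pow ‖_‖, e1]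
    rw [real_inner_comm z.2 z.1, real_inner_comm w.2 z.1]
    simp only [inner_sub_right, inner_add_right, inner_smul_right, Complex.ofReal_sub,
      Complex.ofReal_add, Complex.ofReal_mul, Complex.ofReal_div]
    push_cast
    ring
  rw [h1]
  simp_rw [h2]
  rw [integral_const_mul, integral_sub_right_eq_self (fun t => 
      Complex.exp (-(2 * Real.pi : ℝ) * ‖t‖ ^ 2
        + (2 * Real.pi * Complex.I) * (inner ℝ z.2 t : ℝ))),
    GaussianFourier.integral_cexp_neg_mul_sq_norm_add (by simp [Real.pi_pos])]
  rw [gaussAmb, finrank_euclideanSpace, Fintype.card_fin]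
  have e1 : (Real.pi : ℂ) / ((2 * Real.pi : ℝ) : ℂ) = 1 / 2 := by
    have : (Real.pi : ℂ) ≠ 0 := by exact_mod_cast Real.pi_ne_zero
    push_cast; field_simp
  rw [e1]
  have e2 : Complex.exp (-(Real.pi / 2 * (‖z.1‖ ^ 2 + ‖z.2‖ ^ 2 : ℝ))) =
     Complex.exp (-(Real.pi / 2 * (‖z.1‖ ^ 2 : ℝ))) *
     Complex.exp ((2 * Real.pi * Complex.I) ^ 2 * ‖z.2‖ ^ 2 / (4 * ((2 * Real.pi : ℝ) : ℂ))) := by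
    rw [← Complex.exp_add]
    congr 1
    have : (Real.pi : ℂ) ≠ 0 := by exact_mod_cast Real.pi_ne_zero
    push_cast
    field_simp
    rw [Complex.I_sq]
    ring
  rw [e2]
  ring

/-! ### Continuity of matrix coefficients. -/

lemma norm_rho_apply (z : Phase d) (f : L2 d) : ‖rho z f‖ = ‖f‖ := by
  rw [Lp.norm_def, Lp.norm_def, eLpNorm_congr_ae (rho_apply z f), eLpNorm_shiftFun]

lemma integrable_conj_mul (f g : L2 d) :
    Integrable (fun t => starRingEnd ℂ (f t) * g t) volume :=
  (L2.integrable_inner (𝕜 := ℂ) f g).congr (Filter.Eventually.of_forall fun t => by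
    simp only [RCLike.inner_apply, mul_comm])

lemma continuous_rho_translation (f : L2 d) :
    Continuous fun x : EuclideanSpace ℝ (Fin d) => rho ((x, 0) : Phase d) f := by
  let g : C(EuclideanSpace ℝ (Fin d), C(EuclideanSpace ℝ (Fin d), EuclideanSpace ℝ (Fin d))) :=
    (ContinuousMap.mk (fun p : EuclideanSpace ℝ (Fin d) × EuclideanSpace ℝ (Fin d) => p.2 - p.1)
      (by fun_prop)).curry
  have h := (continuous_const (y := f)).compMeasurePreservingLp (f := fun _ => f) g.continuous
    (fun x => measurePreserving_sub x) ENNReal.ofNat_ne_top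
  refine h.congr fun x => ?_
  refine Lp.ext ((Lp.coeFn_compMeasurePreserving f (measurePreserving_sub x)).trans ?_)
  filter_upwards [rho_apply (x, 0) f] with t ht
  rw [ht]
  simp [shiftFun]

lemma inner_rho_modulation (f e : L2 d) (ξ : EuclideanSpace ℝ (Fin d)) :
    ⟪rho ((0, ξ) : Phase d) f, e⟫_ℂ =
      ∫ t, Complex.exp (-(2 * Real.pi * Complex.I * (inner ℝ ξ t : ℝ))) *
        (starRingEnd ℂ (f t) * e t) := by
  rw [inner_rho]
  refine integral_congr_ae (Filter.Eventually.of_forall fun t => ?_)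
  simp only [shiftFun, map_mul, ← Complex.exp_conj, Complex.conj_ofReal, Complex.conj_I, map_ofNat]
  simp [mul_assoc]

lemma continuous_inner_rho_modulation (f e : L2 d) :
    Continuous fun ξ : EuclideanSpace ℝ (Fin d) => ⟪rho ((0, ξ) : Phase d) f, e⟫_ℂ := by
  simp_rw [inner_rho_modulation]
  refine continuous_of_dominated (bound := fun t => ‖starRingEnd ℂ (f t) * e t‖) (fun ξ => ?_)
    (fun ξ => Filter.Eventually.of_forall fun t => ?_) (integrable_conj_mul f e).norm
    (Filter.Eventually.of_forall fun t => by fun_prop)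
  · exact AEStronglyMeasurable.mul (Continuous.aestronglyMeasurable (by fun_prop))
      (integrable_conj_mul f e).1
  · rw [norm_mul, Complex.norm_exp]
    simp

lemma rho_eq_smul_modulation_translation (z : Phase d) (f : L2 d) :
    rho z f = Complex.exp (-(Real.pi * Complex.I * (inner ℝ z.1 z.2 : ℝ))) •
      rho ((0, z.2) : Phase d) (rho ((z.1, 0) : Phase d) f) := by
  refine Lp.ext ((rho_apply z f).trans ?_)
  filter_upwards [Lp.coeFn_smul (Complex.exp (-(Real.pi * Complex.I * (inner ℝ z.1 z.2 : ℝ))))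
      (rho ((0, z.2) : Phase d) (rho ((z.1, 0) : Phase d) f)),
    rho_apply (0, z.2) (rho ((z.1, 0) : Phase d) f),
    rho_apply (z.1, 0) f] with t h1 h2 h3
  rw [h1, Pi.smul_apply, h2]
  simp only [shiftFun, sub_zero]
  rw [h3]
  simp [shiftFun, mul_assoc]

/-- Matrix coefficients of the time-frequency shifts are continuous. -/
theorem continuous_inner_rho (f e : L2 d) : Continuous fun z : Phase d => ⟪rho z f, e⟫_ℂ := by
  -- Modulations are only shown weakly continuous; joint continuity follows because the coefficient
  -- is Lipschitz in the vector, uniformly in the frequency.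
  have h : Continuous fun p : L2 d × EuclideanSpace ℝ (Fin d) =>
      ⟪rho ((0, p.2) : Phase d) p.1, e⟫_ℂ := by
    refine continuous_prod_of_continuous_lipschitzWith _ ‖e‖₊
      (fun u => continuous_inner_rho_modulation u e) fun ξ =>
      LipschitzWith.of_dist_le_mul fun u v => ?_
    simp only [dist_eq_norm]
    rw [← inner_sub_left, ← map_sub, mul_comm]
    exact (norm_inner_le_norm _ _).trans_eq (by rw [norm_rho_apply]; rfl)
  have hm : Continuous fun z : Phase d => (rho ((z.1, 0) : Phase d) f, z.2) :=
    ((continuous_rho_translation f).comp continuous_fst).prodMk continuous_snd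
  have hphase : Continuous fun z : Phase d =>
      Complex.exp (Real.pi * Complex.I * (inner ℝ z.1 z.2 : ℝ)) := by fun_prop
  refine (hphase.mul (h.comp hm)).congr fun z => ?_
  rw [rho_eq_smul_modulation_translation z f, inner_smul_left, ← Complex.exp_conj]
  simp

lemma norm_inner_rho_le (z : Phase d) (f e : L2 d) : ‖⟪rho z f, e⟫_ℂ‖ ≤ ‖f‖ * ‖e‖ :=
  (norm_inner_le_norm _ _).trans_eq (by rw [norm_rho_apply])

/-! ### Moyal's identity against Gaussians. -/

lemma exists_gaussAmb_eq_ofReal (z : Phase d) : ∃ r : ℝ, 0 < r ∧ gaussAmb z = r := by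
  refine ⟨(1 / 2 : ℝ) ^ (d / 2 : ℝ) * Real.exp (-(Real.pi / 2 * (‖z.1‖ ^ 2 + ‖z.2‖ ^ 2))),
    by positivity, ?_⟩
  rw [gaussAmb]
  push_cast
  rw [Complex.ofReal_cpow (by norm_num)]
  push_cast
  rfl

lemma gaussAmb_ne_zero (z : Phase d) : gaussAmb z ≠ 0 := by
  obtain ⟨r, hr, h⟩ := exists_gaussAmb_eq_ofReal z
  rw [h]; exact_mod_cast hr.ne'

lemma conj_gaussAmb (z : Phase d) : starRingEnd ℂ (gaussAmb z) = gaussAmb z := by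
  obtain ⟨r, hr, h⟩ := exists_gaussAmb_eq_ofReal z
  rw [h, Complex.conj_ofReal]

@[fun_prop]
lemma continuous_gaussAmb : Continuous (gaussAmb (d := d)) := by
  unfold gaussAmb; fun_prop

lemma gaussAmb_eq_mul (x ξ : EuclideanSpace ℝ (Fin d)) : gaussAmb (x, ξ) =
    (1 / 2 : ℂ) ^ (d / 2 : ℂ) * (((Real.exp (-(Real.pi / 2 * ‖x‖ ^ 2)) : ℝ) : ℂ) *
      ((Real.exp (-(Real.pi / 2 * ‖ξ‖ ^ 2)) : ℝ) : ℂ)) := by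
  rw [gaussAmb, ← Complex.ofReal_mul, ← Real.exp_add]
  push_cast
  congr 2
  ring

lemma integrable_gaussAmb : Integrable (gaussAmb (d := d)) := by
  have h := (integrable_exp_neg_mul_sq_norm (V := EuclideanSpace ℝ (Fin d))
    (b := Real.pi / 2) (by positivity)).ofReal (𝕜 := ℂ)
  exact ((h.mul_prod h).const_mul ((1 / 2 : ℂ) ^ (d / 2 : ℂ))).congr
    (Filter.Eventually.of_forall fun z => (gaussAmb_eq_mul z.1 z.2).symm)

lemma integrable_gaussAmb_right (x : EuclideanSpace ℝ (Fin d)) :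
    Integrable (fun ξ => gaussAmb (x, ξ)) := by
  have h := (integrable_exp_neg_mul_sq_norm (V := EuclideanSpace ℝ (Fin d))
    (b := Real.pi / 2) (by positivity)).ofReal (𝕜 := ℂ)
  exact ((h.const_mul _).const_mul _).congr
    (Filter.Eventually.of_forall fun ξ => (gaussAmb_eq_mul x ξ).symm)

/-- Fourier inversion in the frequency variable: it undoes the Gaussian integral defining the
ambiguity function, and the factors `2^{-d/2}` and `2^{d/2}` cancel. -/
lemma integral_phase_mul_gaussAmb (w : Phase d) (x t : EuclideanSpace ℝ (Fin d)) :
    ∫ ξ, Complex.exp (Real.pi * Complex.I * (inner ℝ x ξ : ℝ)) *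
      Complex.exp (-(2 * Real.pi * Complex.I * (inner ℝ ξ t : ℝ))) *
        (symplecticChar w (x, ξ) * gaussAmb (x, ξ)) =
    starRingEnd ℂ (gaussFun w t) * gaussFun w (t - x) := by
  have hpi : (Real.pi : ℂ) ≠ 0 := by exact_mod_cast Real.pi_ne_zero
  have h1 : ∀ ξ : EuclideanSpace ℝ (Fin d),
      Complex.exp (Real.pi * Complex.I * (inner ℝ x ξ : ℝ)) *
      Complex.exp (-(2 * Real.pi * Complex.I * (inner ℝ ξ t : ℝ))) *
        (symplecticChar w (x, ξ) * gaussAmb (x, ξ)) =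
      (1 / 2 : ℂ) ^ (d / 2 : ℂ) *
      Complex.exp (-(2 * Real.pi * Complex.I * (inner ℝ w.2 x : ℝ))
        - (Real.pi / 2 * (‖x‖ ^ 2 : ℝ))) *
      Complex.exp (-(Real.pi / 2 : ℝ) * ‖ξ‖ ^ 2 + (2 * Real.pi * Complex.I) *
        (inner ℝ (w.1 + (1/2 : ℝ) • x - t) ξ : ℝ)) := by
    intro ξ
    rw [mul_assoc ((1 / 2 : ℂ) ^ (d / 2 : ℂ)), ← Complex.exp_add, gaussAmb, symplecticChar,
      ← mul_assoc (Complex.exp _), mul_left_comm, ← Complex.exp_add, ← Complex.exp_add,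
      ← Complex.exp_add]
    congr 2
    simp only [inner_sub_left, inner_add_left, inner_smul_left]
    rw [real_inner_comm ξ t, real_inner_comm ξ w.1, real_inner_comm w.2 x]
    simp only [map_div₀, map_one, map_ofNat]
    push_cast
    ring
  simp_rw [h1]
  rw [integral_const_mul, GaussianFourier.integral_cexp_neg_mul_sq_norm_add
    (by simp [Real.pi_pos]), finrank_euclideanSpace, Fintype.card_fin]
  have e1 : (Real.pi : ℂ) / ((Real.pi / 2 : ℝ) : ℂ) = 2 := by
    push_cast; field_simp
  have e2 : (1 / 2 : ℂ) ^ (d / 2 : ℂ) * (2 : ℂ) ^ (d / 2 : ℂ) = 1 := by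
    rw [one_div, Complex.inv_cpow _ _ (by
      rw [Complex.ofNat_arg]; exact Real.pi_ne_zero.symm), inv_mul_cancel₀]
    simp [Complex.cpow_eq_zero_iff]
  rw [e1, mul_mul_mul_comm, e2, one_mul, ← Complex.exp_add, conj_gaussFun, gaussFun,
    ← Complex.exp_add, ← Complex.exp_add, ← Complex.exp_add]
  congr 1
  have e3 : ‖w.1 + (1/2 : ℝ) • x - t‖ ^ 2 =
      (‖t - w.1‖ ^ 2 + ‖t - x - w.1‖ ^ 2) / 2 - ‖x‖ ^ 2 / 4 := by
    have e2 : t - x - w.1 = (t - w.1) - x := by abel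
    have e3 : w.1 + (1/2 : ℝ) • x - t = -((t - w.1) - (1/2 : ℝ) • x) := by abel
    rw [e2, e3, norm_neg]
    generalize t - w.1 = u
    rw [norm_sub_sq_real, norm_sub_sq_real, inner_smul_right, norm_smul]
    norm_num
    ring
  rw [← Complex.ofReal_pow ‖_‖, e3, inner_sub_right]
  push_cast
  field_simp
  rw [Complex.I_sq]
  ring

lemma conj_shiftFun (z : Phase d) (f : EuclideanSpace ℝ (Fin d) → ℂ)
    (t : EuclideanSpace ℝ (Fin d)) : starRingEnd ℂ (shiftFun z f t) =
      Complex.exp (Real.pi * Complex.I * (inner ℝ z.1 z.2 : ℝ)) *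
      Complex.exp (-(2 * Real.pi * Complex.I * (inner ℝ z.2 t : ℝ))) *
      starRingEnd ℂ (f (t - z.1)) := by
  simp only [shiftFun, map_mul, map_neg, ← Complex.exp_conj, Complex.conj_ofReal, Complex.conj_I,
    map_ofNat]
  simp

lemma integrable_inner_rho_mul (w : Phase d) (f e : L2 d) :
    Integrable fun z : Phase d => ⟪rho z f, e⟫_ℂ * (symplecticChar w z * gaussAmb z) := by
  refine Integrable.bdd_mul (c := ‖f‖ * ‖e‖) (integrable_gaussAmb.bdd_mul (c := 1)
    (continuous_symplecticChar w).aestronglyMeasurable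
    (Filter.Eventually.of_forall fun z => (norm_symplecticChar w z).le))
    (continuous_inner_rho f e).aestronglyMeasurable
    (Filter.Eventually.of_forall fun z => norm_inner_rho_le z f e)

/-- Carrying out the frequency integral first leaves a function of `t` times a function of `t - x`,
which is a convolution in `x`. -/
lemma integral_inner_rho_mul_right (w : Phase d) (f e : L2 d) (x : EuclideanSpace ℝ (Fin d)) :
    ∫ ξ, ⟪rho (x, ξ) f, e⟫_ℂ * (symplecticChar w (x, ξ) * gaussAmb (x, ξ)) =
      ∫ t, (starRingEnd ℂ (gaussFun w t) * e t) *
        (starRingEnd ℂ (f (t - x)) * gaussFun w (t - x)) := by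
  have hp : Integrable (fun t => starRingEnd ℂ (f (t - x)) * e t) := by
    have h := integrable_conj_mul (rho ((x, 0) : Phase d) f) e
    refine h.congr ?_
    filter_upwards [rho_apply (x, 0) f] with t ht
    rw [ht, conj_shiftFun]
    simp
  simp_rw [inner_rho, ← integral_mul_const]
  rw [integral_integral_swap]
  · refine integral_congr_ae (Filter.Eventually.of_forall fun t => ?_)
    have h : ∀ ξ, starRingEnd ℂ (shiftFun (x, ξ) f t) * e t *
        (symplecticChar w (x, ξ) * gaussAmb (x, ξ)) = e t * starRingEnd ℂ (f (t - x)) *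
        (Complex.exp (Real.pi * Complex.I * (inner ℝ x ξ : ℝ)) *
          Complex.exp (-(2 * Real.pi * Complex.I * (inner ℝ ξ t : ℝ))) *
          (symplecticChar w (x, ξ) * gaussAmb (x, ξ))) := fun ξ => by
      rw [conj_shiftFun]
      ring
    simp_rw [h]
    rw [integral_const_mul, integral_phase_mul_gaussAmb]
    ring
  · have h := (integrable_gaussAmb_right x).mul_prod hp
    refine (h.bdd_mul (c := 1) (f := fun p : Phase d =>
      Complex.exp (Real.pi * Complex.I * (inner ℝ x p.1 : ℝ)) *
      Complex.exp (-(2 * Real.pi * Complex.I * (inner ℝ p.1 p.2 : ℝ))) * symplecticChar w (x, p.1))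
      (Continuous.aestronglyMeasurable ?_) ?_).congr
      (Filter.Eventually.of_forall fun p => ?_)
    · have := continuous_symplecticChar w
      fun_prop
    · refine Filter.Eventually.of_forall fun p => ?_
      rw [norm_mul, norm_mul, norm_symplecticChar, Complex.norm_exp, Complex.norm_exp]
      simp
    · simp only [Function.uncurry, conj_shiftFun]
      ring

/-- Moyal's identity against Gaussian matrix coefficients. -/
theorem integral_inner_rho_mul (w : Phase d) (f e : L2 d) :
    ∫ z, ⟪rho z f, e⟫_ℂ * (symplecticChar w z * gaussAmb z) = ⟪gauss w, e⟫_ℂ * ⟪f, gauss w⟫_ℂ := by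
  have hA : ⟪gauss w, e⟫_ℂ = ∫ t, starRingEnd ℂ (gaussFun w t) * e t := by
    rw [L2.inner_def]
    refine integral_congr_ae ?_
    filter_upwards [gauss_apply w] with t ht
    rw [ht, RCLike.inner_apply, mul_comm]
  have hB : ⟪f, gauss w⟫_ℂ = ∫ t, starRingEnd ℂ (f t) * gaussFun w t := by
    rw [L2.inner_def]
    refine integral_congr_ae ?_
    filter_upwards [gauss_apply w] with t ht
    rw [ht, RCLike.inner_apply, mul_comm]
  have hAi : Integrable fun t => starRingEnd ℂ (gaussFun w t) * e t := by
    refine (integrable_conj_mul (gauss w) e).congr ?_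
    filter_upwards [gauss_apply w] with t ht
    rw [ht]
  have hBi : Integrable fun t => starRingEnd ℂ (f t) * gaussFun w t := by
    refine (integrable_conj_mul f (gauss w)).congr ?_
    filter_upwards [gauss_apply w] with t ht
    rw [ht]
  rw [Measure.volume_eq_prod, integral_prod _ (integrable_inner_rho_mul w f e)]
  simp_rw [integral_inner_rho_mul_right]
  -- The second factor is reflected because it is evaluated at `t - x` instead of `x - t`; the
  -- integral of a convolution is the product of the integrals.
  have h := integral_convolution (ContinuousLinearMap.mul ℂ ℂ) hAi hBi.comp_neg
  rw [ContinuousLinearMap.mul_apply', integral_neg_eq_self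
    (fun t => starRingEnd ℂ (f t) * gaussFun w t)] at h
  rw [hA, hB, ← h]
  simp [convolution]

/-! ### Rank-one operators and their Fourier–Wigner transforms. -/

section RankOne

variable {H : Type*} [NormedAddCommGroup H] [InnerProductSpace ℂ H]

lemma isTraceClass_rankOne_self (φ : H) : IsTraceClass (InnerProductSpace.rankOne ℂ φ φ) := by
  have key : ∀ D : SVD (InnerProductSpace.rankOne ℂ φ φ), (∑' i, (D.s i : ℝ≥0∞)) < ∞ →
      IsTraceClass (InnerProductSpace.rankOne ℂ φ φ) := fun D hD => (iInf_le _ D).trans_lt hD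
  -- The zero vector cannot be normalised, so it gets the empty decomposition; otherwise the only
  -- singular value is `‖φ‖²`.
  rcases eq_or_ne φ 0 with rfl | hφ
  · refine key
      { ι := Empty
        countable := inferInstance
        s := Empty.elim
        e := Empty.elim
        η := Empty.elim
        orthonormal_e := ⟨fun i => i.elim, fun i => i.elim⟩
        orthonormal_η := ⟨fun i => i.elim, fun i => i.elim⟩
        hasSum := fun f => by simp } (by simp)
  · have hn : (‖φ‖ : ℂ) ≠ 0 := by exact_mod_cast norm_ne_zero_iff.2 hφ
    have ho : Orthonormal ℂ (fun _ : Unit => ((‖φ‖ : ℂ)⁻¹) • φ) := by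
      refine ⟨fun _ => ?_, fun i j hij => (hij rfl).elim⟩
      rw [norm_smul, norm_inv, Complex.norm_real, norm_norm,
        inv_mul_cancel₀ (norm_ne_zero_iff.2 hφ)]
    refine key
      { ι := Unit
        countable := inferInstance
        s := fun _ => ‖φ‖₊ ^ 2
        e := fun _ => ((‖φ‖ : ℂ)⁻¹) • φ
        η := fun _ => ((‖φ‖ : ℂ)⁻¹) • φ
        orthonormal_e := ho
        orthonormal_η := ho
        hasSum := fun f => by
          convert hasSum_unique (β := Unit) _ using 1
          rw [InnerProductSpace.rankOne_apply, inner_smul_left, smul_smul, smul_smul]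
          congr 1
          simp only [map_inv₀, Complex.conj_ofReal, NNReal.coe_pow, coe_nnnorm,
            Complex.ofReal_pow]
          field_simp } (by simp)

lemma trace_rankOne [CompleteSpace H] (x y : H) :
    trace (InnerProductSpace.rankOne ℂ x y) = ⟪y, x⟫_ℂ := by
  unfold trace
  generalize (exists_hilbertBasis ℂ H).choose_spec.choose = b
  rw [← b.tsum_inner_mul_inner y x]
  refine tsum_congr fun i => ?_
  rw [InnerProductSpace.rankOne_apply, inner_smul_right]

end RankOne

lemma fourierWigner_rankOne (x y : L2 d) (z : Phase d) :
    fourierWigner (InnerProductSpace.rankOne ℂ x y) z = ⟪rho z y, x⟫_ℂ := by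
  rw [fourierWigner, InnerProductSpace.rankOne_comp, ContinuousLinearMap.adjoint_adjoint,
    trace_rankOne]

lemma symplecticChar_zero (z : Phase d) : symplecticChar 0 z = 1 := by
  simp [symplecticChar]

lemma fourierWigner_gauss (z : Phase d) :
    fourierWigner (InnerProductSpace.rankOne ℂ (gauss 0) (gauss (0 : Phase d))) z = gaussAmb z := by
  rw [fourierWigner_rankOne, ← inner_conj_symm, inner_gauss_rho_gauss, symplecticChar_zero, one_mul,
    conj_gaussAmb]

/-! ### Fourier–Wigner series of a singular value decomposition. -/

/-- The continuous function `z ↦ ∑ sᵢ ⟨eᵢ, ρ(z) ηᵢ⟩`, the Fourier–Wigner transform of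
`∑ sᵢ eᵢ ⊗ ηᵢ`. -/
def SVD.transform {S : L2 d →L[ℂ] L2 d} (D : SVD S) (z : Phase d) : ℂ :=
  ∑' i, ((D.s i : ℝ) : ℂ) * ⟪rho z (D.η i), D.e i⟫_ℂ

namespace SVD

variable {S : L2 d →L[ℂ] L2 d} (D : SVD S)

lemma norm_transform_term_le (i : D.ι) (z : Phase d) :
    ‖((D.s i : ℝ) : ℂ) * ⟪rho z (D.η i), D.e i⟫_ℂ‖ ≤ D.s i := by
  have h := norm_inner_rho_le z (D.η i) (D.e i)
  rw [D.orthonormal_η.1 i, D.orthonormal_e.1 i, one_mul] at h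
  rw [norm_mul, Complex.norm_real, Real.norm_of_nonneg (NNReal.coe_nonneg _)]
  exact mul_le_of_le_one_right (NNReal.coe_nonneg _) h

/-- Weierstrass M-test: the `i`-th term is bounded by `s i`, uniformly in `z`. -/
lemma continuous_transform (hD : Summable fun i => (D.s i : ℝ)) : Continuous D.transform :=
  continuous_tsum (fun _ => continuous_const.mul (continuous_inner_rho _ _)) hD
    D.norm_transform_term_le

lemma norm_transform_le (hD : Summable fun i => (D.s i : ℝ)) (z : Phase d) :
    ‖D.transform z‖ ≤ ∑' i, (D.s i : ℝ) :=
  tsum_of_norm_bounded hD.hasSum fun _ => D.norm_transform_term_le _ z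

lemma integrable_transform_mul (hD : Summable fun i => (D.s i : ℝ)) (w : Phase d) :
    Integrable fun z => D.transform z * (symplecticChar w z * gaussAmb z) :=
  (integrable_gaussAmb.bdd_mul (c := 1) (continuous_symplecticChar w).aestronglyMeasurable
    (Filter.Eventually.of_forall fun z => (norm_symplecticChar w z).le)).bdd_mul
    (D.continuous_transform hD).aestronglyMeasurable
    (Filter.Eventually.of_forall (D.norm_transform_le hD))

/-- Moyal's identity term by term; the exchange of sum and integral is dominated by `s i * ∫
‖gaussAmb‖`. -/
lemma integral_transform_mul (hD : Summable fun i => (D.s i : ℝ)) (w : Phase d) :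
    ∫ z, D.transform z * (symplecticChar w z * gaussAmb z) = ⟪gauss w, S (gauss w)⟫_ℂ := by
  have := D.countable
  have h1 := hasSum_integral_of_summable_integral_norm (μ := volume)
    (F := fun i (z : Phase d) => ((D.s i : ℝ) : ℂ) *
      (⟪rho z (D.η i), D.e i⟫_ℂ * (symplecticChar w z * gaussAmb z)))
    (fun i => (integrable_inner_rho_mul w _ _).const_mul _) (by
      refine Summable.of_nonneg_of_le (fun i => integral_nonneg fun z => norm_nonneg _) (fun i => ?_)
        (hD.mul_right (∫ z : Phase d, ‖gaussAmb z‖))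
      rw [← integral_const_mul]
      refine integral_mono ((integrable_inner_rho_mul w _ _).const_mul _).norm
        (integrable_gaussAmb.norm.const_mul _) fun z => ?_
      simp only
      rw [← mul_assoc, norm_mul, norm_mul (symplecticChar w z), norm_symplecticChar, one_mul]
      exact mul_le_mul_of_nonneg_right (D.norm_transform_term_le i z) (norm_nonneg _))
  have h2 : HasSum (fun i => ∫ z : Phase d, ((D.s i : ℝ) : ℂ) *
      (⟪rho z (D.η i), D.e i⟫_ℂ * (symplecticChar w z * gaussAmb z)))
      ⟪gauss w, S (gauss w)⟫_ℂ := by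
    refine HasSum.congr_fun ((innerSL ℂ (gauss w)).hasSum (D.hasSum (gauss w))) fun i => ?_
    rw [integral_const_mul, integral_inner_rho_mul, innerSL_apply_apply, inner_smul_right,
      inner_smul_right]
    ring
  rw [h2.unique h1]
  refine integral_congr_ae (Filter.Eventually.of_forall fun z => ?_)
  simp only [transform, ← mul_assoc, tsum_mul_right]

end SVD

/-- A trace-class Fourier–Wigner multiplier agrees almost everywhere with a bounded continuous
function: the quotient of the Fourier–Wigner transforms of the image of the Gaussian projection
and of the projection itself. -/
theorem exists_boundedContinuousFunction_ae_eq {m : Lp ℂ ∞ (volume : Measure (Phase d))}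
    (hm : m ∈ traceClassMultipliers d) : ∃ g : Phase d →ᵇ ℂ, m =ᵐ[volume] g := by
  obtain ⟨C, hC⟩ := hm
  obtain ⟨S, hS, hS1, -⟩ := hC _ (isTraceClass_rankOne_self (gauss (0 : Phase d)))
  obtain ⟨D, hD⟩ := iInf_lt_iff.1 hS1
  have hs : Summable fun i => (D.s i : ℝ) :=
    NNReal.summable_coe.2 (ENNReal.tsum_coe_ne_top_iff_summable.1 hD.ne)
  have hw : ∀ w : Phase d,
      Integrable (fun z => m z * gaussAmb z * (symplecticChar w z * gaussAmb z)) ∧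
      ⟪gauss w, S (gauss w)⟫_ℂ = ∫ z, m z * gaussAmb z * (symplecticChar w z * gaussAmb z) := by
    intro w
    simpa only [fourierWigner_gauss, inner_gauss_rho_gauss] using hS (gauss w) (gauss w)
  -- One factor `gaussAmb` comes from the operator the multiplier acts on, the outer one from
  -- testing on `gauss w`.
  have hae : (fun z => (m z * gaussAmb z - D.transform z) * gaussAmb z) =ᵐ[volume] 0 := by
    refine ae_eq_zero_of_integral_symplecticChar_eq_zero ?_ fun w => ?_
    · refine ((hw 0).1.sub (D.integrable_transform_mul hs 0)).congr
        (Filter.Eventually.of_forall fun z => ?_)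
      simp only [Pi.sub_apply, symplecticChar_zero]
      ring
    · have h : ∫ z, (m z * gaussAmb z * (symplecticChar w z * gaussAmb z) -
          D.transform z * (symplecticChar w z * gaussAmb z)) = 0 := by
        rw [integral_sub (hw w).1 (D.integrable_transform_mul hs w), ← (hw w).2,
          D.integral_transform_mul hs w, sub_self]
      rw [← h]
      refine integral_congr_ae (Filter.Eventually.of_forall fun z => ?_)
      simp only
      ring
  have hcont : Continuous fun z => D.transform z / gaussAmb z :=
    (D.continuous_transform hs).div continuous_gaussAmb gaussAmb_ne_zero
  have heq : ∀ᵐ z, m z = D.transform z / gaussAmb z := by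
    filter_upwards [hae] with z hz
    rw [eq_div_iff (gaussAmb_ne_zero z), ← sub_eq_zero]
    exact (mul_eq_zero.1 hz).resolve_right (gaussAmb_ne_zero z)
  set K := (eLpNormEssSup m volume).toReal with hK
  have hm_le : ∀ᵐ z, ‖m z‖ ≤ K := by
    filter_upwards [enorm_ae_le_eLpNormEssSup m volume] with z hz
    rw [hK, ← toReal_enorm]
    refine ENNReal.toReal_mono ?_ hz
    rw [← eLpNorm_exponent_top]
    exact Lp.eLpNorm_ne_top m
  -- Since `gaussAmb` decays, the bound must come from `m`: it holds almost everywhere, hence on a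
  -- dense set, hence everywhere by continuity.
  have hbdd : ∀ z, ‖D.transform z / gaussAmb z‖ ≤ K := by
    have hdense : Dense {z : Phase d | ‖D.transform z / gaussAmb z‖ ≤ K} := by
      refine Measure.dense_of_ae (μ := volume) ?_
      filter_upwards [heq, hm_le] with z h1 h2
      rwa [← h1]
    have hclosed : IsClosed {z : Phase d | ‖D.transform z / gaussAmb z‖ ≤ K} :=
      isClosed_le hcont.norm continuous_const
    exact fun z => (hclosed.closure_eq ▸ hdense z :)
  exact ⟨BoundedContinuousFunction.ofNormedAddCommGroup _ hcont K hbdd, heq⟩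

end FourierWigner

theorem mainTheorem9 (d : ℕ) (m : Lp ℂ ∞ (volume : Measure (FourierWigner.Phase d)))
    (hm : m ∈ FourierWigner.traceClassMultipliers d) :
    ∃ g : FourierWigner.Phase d →ᵇ ℂ, m =ᵐ[volume] g :=
  FourierWigner.exists_boundedContinuousFunction_ae_eq hm

end
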